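/- Let $k$ be an algebraically closed field and let $H$ be a Hopf algebra over $k$. Let $G$ be an abelian group of group-like elements of $H$ and let $a_1,\dots,a_t\in H$ (with $t\ge 0$) be skew-primitive with respect to $G$, that is, for every $i$ there are $g_i,h_i\in G$ with $\Delta(a_i)=g_i\otimes a_i+a_i\otimes h_i$. Assume that $H$ is generated as an algebra by $G$ and $a_1,\dots,a_t$, and that the $k$-linear span of $a_1,\dots,a_t$ is stable under the adjoint action $x\mapsto gxg^{-1}$ of every $g\in G$. Then $H$ has a PBW basis $(G,S,<,h)$: there are a subset $S\subset H$, a total order $<$ on $S$ and a height function $h:S\to\{1,2,3,\dots\}\cup\{\infty\}$ such that the products \[ s_1^{e_1}s_2^{e_2}\cdots s_r^{e_r}\,g,\qquad r\ge 0,\quad s_1>s_2>\dots>s_r \text{ in } S,\quad e_i\in\mathbb{Z},\ 0<e_i<h(s_i),\quad g\in G, \] are pairwise different (for different data $r,(s_i),(e_i),g$) and form a basis of the $k$-vector space $H$. -/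

import Mathlib

open scoped TensorProduct

noncomputable section

namespace PBW

/-- `a` is `(g, h)`-skew-primitive: `Δ(a) = g ⊗ a + a ⊗ h`, where `g` and `h` are group-like. -/
def IsSkewPrimitive (k : Type*) {H : Type*} [Field k] [Ring H] [HopfAlgebra k H]
    (g h : GroupLike k H) (a : H) : Prop :=
  Coalgebra.comul (R := k) a = (g : H) ⊗ₜ[k] a + a ⊗ₜ[k] (h : H)

/-- The adjoint action `g ▷ x = g x g⁻¹` of a group-like element `g` on a Hopf algebra. It is the
Hopf-theoretic adjoint action `g₍₁₎ x S(g₍₂₎)`, because `Δ(g) = g ⊗ g` and `S(g) = g⁻¹`. -/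
def adjointAction {k H : Type*} [Field k] [Ring H] [HopfAlgebra k H]
    (g : GroupLike k H) (x : H) : H :=
  (g : H) * x * ((g⁻¹ : GroupLike k H) : H)

section Basis

variable {A : Type*} [Ring A] (S : Set A) [LinearOrder S]

/-- The ordered monomial `s₁ ^ e₁ * ⋯ * s_t ^ e_t`, where `s₁ > ⋯ > s_t` are the elements of the
support of `e` and `eᵢ = e sᵢ > 0`. -/
def monomial (e : S →₀ ℕ) : A :=
  ((e.support.sort (· ≥ ·)).map fun s : S => (s : A) ^ e s).prod

/-- The exponents that the height function `h` allows: `0 < e s < h s` for every `s` that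
occurs. -/
def Exponents (h : S → ℕ∞) : Type _ :=
  {e : S →₀ ℕ // ∀ s ∈ e.support, (e s : ℕ∞) < h s}

/-- The products `s₁ ^ e₁ * ⋯ * s_t ^ e_t * p` that make up the PBW set generated by `P`,
`(S, <)` and `h`, as a family indexed by the expressions (exponents, element of `P`). -/
def product (P : Set A) (h : S → ℕ∞) (b : Exponents S h × P) : A :=
  monomial S b.1.1 * (b.2 : A)

/-- The PBW set `B(P, S, <, h)`. -/
def pbwSet (P : Set A) (h : S → ℕ∞) : Set A :=
  Set.range (product S P h)

/-- `(P, S, <, h)` is a PBW basis of the `k`-algebra `A`: the heights are positive integers or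
`∞`, different expressions give different products, and the PBW set `B(P, S, <, h)` is a basis of
the vector space `A`. -/
structure IsPBWBasis (k : Type*) [Field k] [Algebra k A] (P : Set A) (h : S → ℕ∞) : Prop where
  height_pos : ∀ s, 0 < h s
  injective : Function.Injective (product S P h)
  linearIndepOn : LinearIndepOn k id (pbwSet S P h)
  span_eq_top : Submodule.span k (pbwSet S P h) = ⊤

end Basis

end PBW

end

/-!
Order words by length and, among words of equal length, with the lexicographically larger ones
first. A word is *irreducible* if its product is not a linear combination of smaller words with
coefficients from `G`. By induction along this well-order, the irreducible words with coefficients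
from `G` span `H`.

A commuting family of operators on a finite-dimensional space over an algebraically closed field is
simultaneously triangular. Applied to the adjoint action on the skew-primitive generators, this
gives letters past which elements of `G` can be moved at the cost of smaller words only. Up to
smaller words, the coproduct of a word is then the sum of its shuffle splittings. Evaluating it on
pairs of functionals that vanish on smaller words, one of them dual to a group-like element, shows
that the irreducible words with coefficients from `G` are linearly independent. Evaluating it at the
cut of `a ++ b` shows that `a ++ b` is irreducible if `a` and `b` are and `b` is smaller than every
suffix of `a`, because `a ++ b` is then the largest shuffle of `a` and `b`.

By the Chen–Fox–Lyndon theorem a word is a unique nonincreasing product of Lyndon words, and the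
closure property just found says that it is irreducible if and only if the power with which each
Lyndon word occurs in it is. The PBW generators are thus the irreducible Lyndon words.
-/

noncomputable section

namespace PBW

/-! ### Words and shuffles -/

section Shuffle

variable {α : Type*} {u v w : List α}

/-- `Shuffle u v w`: the word `w` is a shuffle of `u` and `v`. -/
inductive Shuffle : List α → List α → List α → Prop
  | nil : Shuffle [] [] []
  | left {u v w : List α} (x : α) : Shuffle u v w → Shuffle (x :: u) v (x :: w)
  | right {u v w : List α} (x : α) : Shuffle u v w → Shuffle u (x :: v) (x :: w)

/-- `Crossing u v w`: the word `w` is a shuffle of `u` and `v` in which some letter of `v` precedes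
some letter of `u`. -/
inductive Crossing : List α → List α → List α → Prop
  | left {u v w : List α} (x : α) : Crossing u v w → Crossing (x :: u) v (x :: w)
  | right {u v w : List α} (x y : α) : Shuffle (x :: u) v w → Crossing (x :: u) (y :: v) (y :: w)

theorem Shuffle.length_eq (h : Shuffle u v w) : u.length + v.length = w.length := by
  induction h <;> simp_all <;> omega

theorem Shuffle.nil_left (v : List α) : Shuffle [] v v := by
  induction v with
  | nil => exact .nil
  | cons b _ ih => exact ih.right b

theorem Shuffle.append (u v : List α) : Shuffle u v (u ++ v) := by
  induction u with
  | nil => exact .nil_left v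
  | cons a _ ih => exact ih.left a

theorem Crossing.shuffle (h : Crossing u v w) : Shuffle u v w := by
  induction h with
  | left x _ ih => exact ih.left x
  | right _ y h => exact h.right y

theorem Crossing.ne_nil (h : Crossing u v w) : u ≠ [] ∧ v ≠ [] := by
  induction h with
  | left _ _ ih => exact ⟨List.cons_ne_nil _ _, ih.2⟩
  | right => exact ⟨List.cons_ne_nil _ _, List.cons_ne_nil _ _⟩

theorem exists_crossing (hu : u ≠ []) (hv : v ≠ []) : ∃ w, Crossing u v w := by
  obtain ⟨a, u, rfl⟩ := List.exists_cons_of_ne_nil hu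
  obtain ⟨b, v, rfl⟩ := List.exists_cons_of_ne_nil hv
  exact ⟨_, .right a b (.append _ _)⟩

theorem Shuffle.eq_append_or_crossing (h : Shuffle u v w) : w = u ++ v ∨ Crossing u v w := by
  induction h with
  | nil => exact .inl rfl
  | left x _ ih =>
    rcases ih with rfl | h
    · exact .inl rfl
    · exact .inr (h.left x)
  | @right u _ _ x h ih =>
    cases u with
    | nil =>
      rcases ih with rfl | h
      · exact .inl rfl
      · exact absurd rfl h.ne_nil.1
    | cons a _ => exact .inr (.right a x h)

end Shuffle

section Suffix

variable {α : Type*}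

theorem suffix_append_iff {l m s : List α} :
    s <:+ l ++ m ↔ s <:+ m ∨ ∃ r, r <:+ l ∧ s = r ++ m := by
  constructor
  · intro hs
    refine (List.suffix_or_suffix_of_suffix hs (List.suffix_append l m)).imp_right ?_
    rintro ⟨r, rfl⟩
    exact ⟨r, List.suffix_append_self_iff.1 hs, rfl⟩
  · rintro (hs | ⟨r, hr, rfl⟩)
    exacts [hs.trans (List.suffix_append l m), List.suffix_append_self_iff.2 hr]

theorem exists_suffix_prefix_of_append_eq_flatten {L : List (List α)} {r s : List α} (hr : r ≠ [])
    (h : r ++ s = L.flatten) : ∃ p, p <:+ r ∧ p ≠ [] ∧ ∃ m ∈ L, p <+: m := by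
  induction L generalizing r with
  | nil => simp_all
  | cons m L ih =>
    rw [List.flatten_cons] at h
    rcases List.append_eq_append_iff.1 h with ⟨t, rfl, -⟩ | ⟨r', rfl, hr's⟩
    · exact ⟨r, List.suffix_rfl, hr, _, List.mem_cons_self, List.prefix_append r t⟩
    · rcases eq_or_ne r' [] with rfl | hr'
      · rw [List.append_nil] at hr ⊢
        exact ⟨m, List.suffix_rfl, hr, m, List.mem_cons_self, List.prefix_rfl⟩
      · obtain ⟨p, hp, hp', x, hx, hpx⟩ := ih hr' hr's.symm
        exact ⟨p, hp.trans (List.suffix_append m r'), hp', x, List.mem_cons_of_mem _ hx, hpx⟩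

end Suffix

section Lexicographic

variable {α : Type*} [LinearOrder α] {a b l m u v w : List α}

theorem nil_lt_iff_ne_nil : [] < l ↔ l ≠ [] := by
  cases l <;> simp

theorem ne_nil_of_lt (h : l < m) : m ≠ [] := by
  rintro rfl
  exact List.not_lt_nil l h

theorem cons_le_cons_iff {x y : α} : x :: l ≤ y :: m ↔ x < y ∨ x = y ∧ l ≤ m := by
  rw [le_iff_lt_or_eq, List.cons_lt_cons_iff, le_iff_lt_or_eq, List.cons.injEq]
  tauto

theorem le_append (l m : List α) : l ≤ l ++ m := by
  rcases eq_or_ne m [] with rfl | h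
  · rw [List.append_nil]
  · simpa using (List.append_left_lt (l₁ := l) (nil_lt_iff_ne_nil.2 h)).le

theorem append_lt_append_or_exists_eq_append (h : l < m) :
    (∀ r s, l ++ r < m ++ s) ∨ ∃ t, t ≠ [] ∧ m = l ++ t := by
  induction l generalizing m with
  | nil => exact .inr ⟨m, ne_nil_of_lt h, rfl⟩
  | cons x l ih =>
    obtain ⟨y, m, rfl⟩ := List.exists_cons_of_ne_nil (ne_nil_of_lt h)
    rcases List.cons_lt_cons_iff.1 h with hxy | ⟨rfl, hlm⟩
    · exact .inl fun r s => List.cons_lt_cons_iff.2 (.inl hxy)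
    · rcases ih hlm with hlt | ⟨t, ht, rfl⟩
      · exact .inl fun r s => List.cons_lt_cons_iff.2 (.inr ⟨rfl, hlt r s⟩)
      · exact .inr ⟨t, ht, rfl⟩

theorem append_lt_append_of_length_eq (h : l < m) (hl : l.length = m.length) (r s : List α) :
    l ++ r < m ++ s := by
  rcases append_lt_append_or_exists_eq_append h with hlt | ⟨t, ht, rfl⟩
  · exact hlt r s
  · simp_all

/-! ### The largest shuffle of two words -/

/-- `PrecedesSuffixes b a`: the word `b` is smaller than every nonempty suffix of `a`. This is what
makes `a ++ b` the largest shuffle of `a` and `b`. -/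
def PrecedesSuffixes (b a : List α) : Prop :=
  ∀ s, s <:+ a → s ≠ [] → b < s

theorem PrecedesSuffixes.of_suffix (h : PrecedesSuffixes b a) (hl : l <:+ a) :
    PrecedesSuffixes b l :=
  fun s hs => h s (hs.trans hl)

theorem Shuffle.exists_le {u' v' : List α} (h : Shuffle u v w) (hul : u.length = u'.length)
    (hvl : v.length = v'.length) (hu : u ≤ u') (hv : v ≤ v') :
    ∃ w', Shuffle u' v' w' ∧ w ≤ w' := by
  induction h generalizing u' v' with
  | nil => exact ⟨_, .append u' v', le_append [] _⟩
  | left x _ ih =>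
    obtain ⟨y, u', rfl⟩ := List.exists_cons_of_length_eq_add_one hul.symm
    rcases cons_le_cons_iff.1 hu with hxy | ⟨rfl, hu'⟩
    · exact ⟨_, (Shuffle.append u' v').left y, cons_le_cons_iff.2 (.inl hxy)⟩
    · obtain ⟨w', hw', hle⟩ := ih (by simpa using hul) hvl hu' hv
      exact ⟨_, hw'.left x, cons_le_cons_iff.2 (.inr ⟨rfl, hle⟩)⟩
  | right x _ ih =>
    obtain ⟨y, v', rfl⟩ := List.exists_cons_of_length_eq_add_one hvl.symm
    rcases cons_le_cons_iff.1 hv with hxy | ⟨rfl, hv'⟩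
    · exact ⟨_, (Shuffle.append u' v').right y, cons_le_cons_iff.2 (.inl hxy)⟩
    · obtain ⟨w', hw', hle⟩ := ih hul (by simpa using hvl) hu hv'
      exact ⟨_, hw'.right x, cons_le_cons_iff.2 (.inr ⟨rfl, hle⟩)⟩

theorem Crossing.exists_le {u' v' : List α} (h : Crossing u v w) (hul : u.length = u'.length)
    (hvl : v.length = v'.length) (hu : u ≤ u') (hv : v ≤ v') :
    ∃ w', Crossing u' v' w' ∧ w ≤ w' := by
  induction h generalizing u' v' with
  | left x h ih =>
    obtain ⟨y, u', rfl⟩ := List.exists_cons_of_length_eq_add_one hul.symm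
    rw [List.length_cons, List.length_cons, add_left_inj] at hul
    rcases cons_le_cons_iff.1 hu with hxy | ⟨rfl, hu'⟩
    · obtain ⟨w', hw'⟩ := exists_crossing
        (List.ne_nil_of_length_pos (hul ▸ List.length_pos_of_ne_nil h.ne_nil.1))
        (List.ne_nil_of_length_pos (hvl ▸ List.length_pos_of_ne_nil h.ne_nil.2))
      exact ⟨_, hw'.left y, cons_le_cons_iff.2 (.inl hxy)⟩
    · obtain ⟨w', hw', hle⟩ := ih hul hvl hu' hv
      exact ⟨_, hw'.left x, cons_le_cons_iff.2 (.inr ⟨rfl, hle⟩)⟩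
  | right x y h =>
    obtain ⟨x', u', rfl⟩ := List.exists_cons_of_length_eq_add_one hul.symm
    obtain ⟨y', v', rfl⟩ := List.exists_cons_of_length_eq_add_one hvl.symm
    rcases cons_le_cons_iff.1 hv with hyy' | ⟨rfl, hv'⟩
    · exact ⟨_, .right x' y' (.append _ _), cons_le_cons_iff.2 (.inl hyy')⟩
    · obtain ⟨w', hw', hle⟩ := h.exists_le hul (by simpa using hvl) hu hv'
      exact ⟨_, .right x' y hw', cons_le_cons_iff.2 (.inr ⟨rfl, hle⟩)⟩

/-- Moving a prefix `p` from the larger to the smaller constituent makes the shuffles larger. -/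
theorem Shuffle.exchange {p : List α} (h : Shuffle (p ++ u) v w) (hvu : v < u) (hp : p ≠ []) :
    (∃ w', Crossing u (p ++ v) w' ∧ w ≤ w') ∨ ∃ w', Shuffle u (p ++ v) w' ∧ w < w' := by
  induction w generalizing p u v with
  | nil =>
    have := h.length_eq
    cases p <;> simp_all
  | cons c w ih =>
    obtain ⟨x, u, rfl⟩ := List.exists_cons_of_ne_nil (ne_nil_of_lt hvu)
    obtain ⟨y, p, rfl⟩ := List.exists_cons_of_ne_nil hp
    cases h with
    | left _ h =>
      rcases eq_or_ne p [] with rfl | hp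
      · exact .inl ⟨_, .right x _ h, le_rfl⟩
      · rcases ih h hvu hp with ⟨w', hw', hle⟩ | ⟨w', hw', hlt⟩
        · exact .inl ⟨_, .right x _ hw'.shuffle, cons_le_cons_iff.2 (.inr ⟨rfl, hle⟩)⟩
        · exact .inl ⟨_, .right x _ hw', cons_le_cons_iff.2 (.inr ⟨rfl, hlt.le⟩)⟩
    | @right _ v _ _ h =>
      rcases List.cons_lt_cons_iff.1 hvu with hcx | ⟨rfl, hvu'⟩
      · exact .inr ⟨_, (Shuffle.append u _).left x, List.cons_lt_cons_iff.2 (.inl hcx)⟩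
      · have h' : Shuffle ((y :: p ++ [c]) ++ u) v w := by simpa using h
        rcases ih h' hvu' (by simp) with ⟨w', hw', hle⟩ | ⟨w', hw', hlt⟩
        · exact .inl ⟨_, .left c (by simpa using hw'), cons_le_cons_iff.2 (.inr ⟨rfl, hle⟩)⟩
        · exact .inr ⟨_, .left c (by simpa using hw'), List.cons_lt_cons_iff.2 (.inr ⟨rfl, hlt⟩)⟩

theorem Crossing.lt_append (h : Crossing u v w) (huv : PrecedesSuffixes v u) : w < u ++ v := by
  induction u generalizing w with
  | nil => exact absurd rfl h.ne_nil.1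
  | cons x u ih =>
    have ih {w} (hw : Crossing u v w) : w < u ++ v :=
      ih hw (huv.of_suffix (List.suffix_cons x u))
    cases h with
    | left _ h => exact List.cons_lt_cons_iff.2 (.inr ⟨rfl, ih h⟩)
    | @right _ v w _ c h =>
      refine List.cons_lt_cons_iff.2 ?_
      rcases List.cons_lt_cons_iff.1 (huv _ List.suffix_rfl (by simp)) with hcx | ⟨rfl, hvu⟩
      · exact .inl hcx
      · have h' : Shuffle ([c] ++ u) v w := h
        rcases h'.exchange hvu (by simp) with ⟨w', hw', hle⟩ | ⟨w', hw', hlt⟩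
        · exact .inr ⟨rfl, hle.trans_lt (ih hw')⟩
        · rcases hw'.eq_append_or_crossing with rfl | hw'
          · exact .inr ⟨rfl, hlt⟩
          · exact .inr ⟨rfl, hlt.trans (ih hw')⟩

theorem Shuffle.le_append (h : Shuffle u v w) (huv : PrecedesSuffixes v u) : w ≤ u ++ v := by
  rcases h.eq_append_or_crossing with rfl | h
  · exact le_rfl
  · exact (h.lt_append huv).le

/-! ### The well-order on words -/

/-- The words that are shorter than `w`, or of the same length and lexicographically larger. -/
def below (w : List α) : Set (List α) :=
  {v | List.Shortlex (· > ·) v w}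

/-- The words of the same length as `w` that are lexicographically not smaller. -/
def upper (w : List α) : Set (List α) :=
  {v | v.length = w.length ∧ w ≤ v}

theorem lex_gt_iff_lt_of_length_eq (h : v.length = w.length) :
    List.Lex (· > ·) v w ↔ w < v := by
  induction v generalizing w with
  | nil =>
    obtain rfl := List.eq_nil_of_length_eq_zero h.symm
    simp
  | cons x v ih =>
    obtain ⟨y, w, rfl⟩ := List.exists_cons_of_length_eq_add_one h.symm
    rw [List.cons_lex_cons_iff, List.cons_lt_cons_iff, ih (by simpa using h), eq_comm, gt_iff_lt]

theorem mem_below_iff :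
    v ∈ below w ↔ v.length < w.length ∨ v.length = w.length ∧ w < v := by
  rw [below, Set.mem_ofPred_eq, List.shortlex_def]
  exact or_congr_right (and_congr_right lex_gt_iff_lt_of_length_eq)

theorem notMem_below_nil : v ∉ below ([] : List α) :=
  List.not_shortlex_nil_right

theorem mem_upper_self (w : List α) : w ∈ upper w := ⟨rfl, le_rfl⟩

theorem cons_mem_upper_cons {i j : α} (hij : i ≤ j) (h : v ∈ upper w) :
    j :: v ∈ upper (i :: w) :=
  ⟨by simp [h.1], cons_le_cons_iff.2 (hij.lt_or_eq.imp_right fun e => ⟨e, h.2⟩)⟩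

theorem upper_subset_upper (h : v ∈ upper w) : upper v ⊆ upper w :=
  fun _ hu => ⟨hu.1.trans h.1, h.2.trans hu.2⟩

theorem upper_subset_below (h : v ∈ below w) : upper v ⊆ below w := by
  rintro u ⟨hl, hle⟩
  rw [mem_below_iff] at h ⊢
  rcases h with h | ⟨h, hlt⟩
  · exact .inl (hl.trans_lt h)
  · exact .inr ⟨hl.trans h, hlt.trans_le hle⟩

theorem below_subset_below (h : v ∈ below w) : below v ⊆ below w := by
  intro u hu
  rcases mem_below_iff.1 hu with hu | ⟨hl, hlt⟩
  · refine mem_below_iff.2 (.inl (hu.trans_le ?_))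
    rcases mem_below_iff.1 h with h | h
    exacts [h.le, h.1.le]
  · exact upper_subset_below h ⟨hl, hlt.le⟩

theorem notMem_below_iff :
    v ∉ below w ↔ w.length ≤ v.length ∧ (v.length = w.length → v ≤ w) := by
  simp only [mem_below_iff, not_or, not_and, not_lt]

theorem append_append_mem_below {q q' : List α} (p : List α) (h : v ∈ below w)
    (hq : q'.length = q.length) : p ++ v ++ q' ∈ below (p ++ w ++ q) := by
  simp only [mem_below_iff, List.length_append, List.append_assoc] at h ⊢
  rcases h with h | ⟨h, hlt⟩
  · exact .inl (by omega)
  · exact .inr ⟨by omega, List.append_left_lt (append_lt_append_of_length_eq hlt h.symm _ _)⟩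

theorem mem_below_or_mem_below_of_shuffle (h : Shuffle u v w) (hab : PrecedesSuffixes b a)
    (hw : w ∈ below (a ++ b)) : u ∈ below a ∨ v ∈ below b := by
  by_contra! hc
  obtain ⟨⟨hau, hu⟩, hbv, hv⟩ := hc.imp notMem_below_iff.1 notMem_below_iff.1
  have hl := h.length_eq
  rw [mem_below_iff, List.length_append] at hw
  obtain ⟨-, hlt⟩ := hw.resolve_left (by omega)
  have hul : u.length = a.length := by omega
  have hvl : v.length = b.length := by omega
  obtain ⟨w', hw', hle⟩ := h.exists_le hul hvl (hu hul) (hv hvl)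
  exact (hlt.trans_le (hle.trans (hw'.le_append hab))).false

theorem mem_below_or_mem_below_of_crossing (h : Crossing u v (a ++ b))
    (hab : PrecedesSuffixes b a) : u ∈ below a ∨ v ∈ below b := by
  by_contra! hc
  obtain ⟨⟨hau, hu⟩, hbv, hv⟩ := hc.imp notMem_below_iff.1 notMem_below_iff.1
  have hl := h.shuffle.length_eq
  rw [List.length_append] at hl
  have hul : u.length = a.length := by omega
  have hvl : v.length = b.length := by omega
  obtain ⟨w', hw', hle⟩ := h.exists_le hul hvl (hu hul) (hv hvl)
  exact (hle.trans_lt (hw'.lt_append hab)).false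

/-! ### Lyndon words -/

/-- A Lyndon word: a nonempty word that is smaller than its proper nonempty suffixes. -/
def IsLyndon (w : List α) : Prop :=
  w ≠ [] ∧ ∀ s, s <:+ w → s ≠ [] → s ≠ w → w < s

/-- A nonincreasing sequence of Lyndon words; by the Chen–Fox–Lyndon theorem every word is the
product of exactly one such sequence. -/
structure IsLyndonSequence (L : List (List α)) : Prop where
  isLyndon : ∀ l ∈ L, IsLyndon l
  pairwise_ge : L.Pairwise (· ≥ ·)

theorem isLyndon_singleton (x : α) : IsLyndon [x] :=
  ⟨by simp, fun s hs hs' hne => by simp_all [List.suffix_cons_iff]⟩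

theorem IsLyndon.le_of_suffix (hl : IsLyndon l) (hs : m <:+ l) (hm : m ≠ []) : l ≤ m := by
  rcases eq_or_ne m l with rfl | hne
  exacts [le_rfl, (hl.2 m hs hm hne).le]

theorem IsLyndon.append_lt (hl : l ≠ []) (hm : IsLyndon m) (h : l < m) : l ++ m < m := by
  rcases append_lt_append_or_exists_eq_append h with hlt | ⟨t, ht, rfl⟩
  · simpa using hlt m []
  · exact List.append_left_lt (hm.2 t (List.suffix_append l t) ht (by simpa using hl))

theorem IsLyndon.append (hl : IsLyndon l) (hm : IsLyndon m) (h : l < m) : IsLyndon (l ++ m) := by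
  have hlm : l ++ m < m := hm.append_lt hl.1 h
  refine ⟨by simp [hl.1], fun s hs hs' hne => ?_⟩
  rcases suffix_append_iff.1 hs with hs | ⟨r, hr, rfl⟩
  · exact hlm.trans_le (hm.le_of_suffix hs hs')
  rcases eq_or_ne r [] with rfl | hr'
  · exact hlm
  have hrl : r ≠ l := by simpa using hne
  rcases append_lt_append_or_exists_eq_append (hl.2 r hr hr' hrl) with hlt | ⟨t, ht, rfl⟩
  · exact hlt m m
  · exact absurd (by simpa using hr.length_le) ht

theorem IsLyndonSequence.of_cons {L : List (List α)} (hL : IsLyndonSequence (l :: L)) :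
    IsLyndonSequence L :=
  ⟨fun m hm => hL.1 m (by simp [hm]), (List.pairwise_cons.1 hL.2).2⟩

theorem IsLyndonSequence.exists_flatten_eq_append {L : List (List α)} (hL : IsLyndonSequence L)
    (hm : IsLyndon m) : ∃ M, IsLyndonSequence M ∧ M.flatten = m ++ L.flatten := by
  induction L generalizing m with
  | nil => exact ⟨[m], ⟨by simpa using hm, by simp⟩, by simp⟩
  | cons l L ih =>
    rcases le_or_gt l m with h | h
    · have hle : ∀ x ∈ l :: L, x ≤ m := by
        simpa [h] using fun x hx => ((List.pairwise_cons.1 hL.2).1 x hx).trans h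
      exact ⟨m :: l :: L, ⟨by simpa [hm] using hL.1, List.pairwise_cons.2 ⟨hle, hL.2⟩⟩, by simp⟩
    · obtain ⟨M, hM, hflat⟩ := ih hL.of_cons (hm.append (hL.1 l (by simp)) h)
      exact ⟨M, hM, by simpa using hflat⟩

theorem exists_isLyndonSequence_flatten_eq (w : List α) :
    ∃ L, IsLyndonSequence L ∧ L.flatten = w := by
  induction w with
  | nil => exact ⟨[], ⟨by simp, by simp⟩, rfl⟩
  | cons x w ih =>
    obtain ⟨L, hL, rfl⟩ := ih
    exact hL.exists_flatten_eq_append (isLyndon_singleton x)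

theorem IsLyndon.eq_of_prefix_flatten {r s : List α} {L : List (List α)}
    (hl : IsLyndon (m ++ r)) (hm : m ≠ []) (hL : ∀ x ∈ L, x ≤ m) (h : r ++ s = L.flatten) :
    m ++ r = m := by
  rcases eq_or_ne r [] with rfl | hr
  · exact List.append_nil m
  · obtain ⟨p, hpr, hp, x, hx, t, rfl⟩ := exists_suffix_prefix_of_append_eq_flatten hr h
    have hpne : p ≠ m ++ r := by
      rintro rfl
      simpa [hm] using hpr.length_le
    have hlt : m ++ r < p := hl.2 p (hpr.trans (List.suffix_append m r)) hp hpne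
    have hle : p ≤ m := (le_append p t).trans (hL _ hx)
    exact absurd (hlt.trans_le (hle.trans (le_append m r))) (lt_irrefl _)

theorem IsLyndonSequence.flatten_injOn :
    Set.InjOn List.flatten {L : List (List α) | IsLyndonSequence L} := by
  intro L hL M hM h
  induction L generalizing M with
  | nil =>
    cases M with
    | nil => rfl
    | cons m M => exact absurd (by simp_all) (hM.1 m (by simp)).1
  | cons l L ih =>
    cases M with
    | nil => exact absurd (by simp_all) (hL.1 l (by simp)).1
    | cons m M =>
      have hl := hL.1 l (by simp)
      have hm := hM.1 m (by simp)
      rw [List.flatten_cons, List.flatten_cons] at h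
      have hlm : l = m := by
        rcases List.append_eq_append_iff.1 h with ⟨r, rfl, hr⟩ | ⟨r, rfl, hr⟩
        · exact (hm.eq_of_prefix_flatten hl.1 (List.pairwise_cons.1 hL.2).1 hr.symm).symm
        · exact hl.eq_of_prefix_flatten hm.1 (List.pairwise_cons.1 hM.2).1 hr.symm
      subst hlm
      rw [ih hL.of_cons hM.of_cons (List.append_cancel_left h)]

theorem IsLyndon.le_of_suffix_pow {s : List α} (hl : IsLyndon l) (n : ℕ)
    (hs : s <:+ (List.replicate n l).flatten) (hs' : s ≠ []) : l ≤ s := by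
  induction n with
  | zero => simp_all
  | succ n ih =>
    rw [List.replicate_succ, List.flatten_cons] at hs
    rcases suffix_append_iff.1 hs with hs | ⟨r, hr, rfl⟩
    · exact ih hs
    · rcases eq_or_ne r [] with rfl | hr'
      · exact ih List.suffix_rfl
      · exact (hl.le_of_suffix hr hr').trans (le_append _ _)

theorem flatten_lt_of_forall_precedesSuffixes {L : List (List α)} (hm : m ≠ [])
    (h : ∀ l ∈ L, PrecedesSuffixes l m) : L.flatten < m := by
  induction L generalizing m with
  | nil => exact nil_lt_iff_ne_nil.2 hm
  | cons l L ih =>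
    have hlm : l < m := h l (by simp) m List.suffix_rfl hm
    rcases append_lt_append_or_exists_eq_append hlm with hlt | ⟨t, ht, rfl⟩
    · simpa using hlt L.flatten []
    · exact List.append_left_lt (ih ht fun x hx =>
        (h x (by simp [hx])).of_suffix (List.suffix_append l t))

theorem IsLyndon.flatten_precedesSuffixes_pow (hl : IsLyndon l) (n : ℕ) {L : List (List α)}
    (hL : ∀ m ∈ L, m < l) : PrecedesSuffixes L.flatten (List.replicate n l).flatten :=
  fun _ hs hs' => flatten_lt_of_forall_precedesSuffixes hs' fun m hm _ ht ht' =>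
    (hL m hm).trans_le (hl.le_of_suffix_pow n (ht.trans hs) ht')

end Lexicographic

section PowerProduct

variable {α σ : Type*} [LinearOrder σ]

theorem sort_toMultiset (e : σ →₀ ℕ) :
    (Finsupp.toMultiset e).sort (· ≥ ·) =
      (e.support.sort (· ≥ ·)).flatMap fun s => List.replicate (e s) s := by
  refine List.Perm.eq_of_pairwise (le := (· ≥ ·)) (fun _ _ _ _ h h' => le_antisymm h' h)
    (Multiset.pairwise_sort _ _) (List.pairwise_flatMap.2 ⟨fun s _ => ?_, ?_⟩) ?_
  · simp [List.pairwise_replicate]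
  · refine (Finset.pairwise_sort e.support (· ≥ ·)).imp fun h x hx y hy => ?_
    rwa [List.eq_of_mem_replicate hx, List.eq_of_mem_replicate hy]
  · rw [← Multiset.coe_eq_coe, Multiset.sort_eq]
    ext s
    rw [Finsupp.count_toMultiset, Multiset.coe_count, List.count_flatMap,
      ← List.sum_toFinset _ (Finset.sort_nodup _ _), Finset.sort_toFinset,
      Finset.sum_eq_single s (by simp +contextual [List.count_replicate])
        (by simp +contextual)]
    simp

/-- The ordered product of the words `word s`, in decreasing order of `s` and with exponents
`e s`. -/
def powerProduct (word : σ → List α) (e : σ →₀ ℕ) : List α :=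
  (((Finsupp.toMultiset e).sort (· ≥ ·)).map word).flatten

theorem powerProduct_eq_flatten_flatMap (word : σ → List α) (e : σ →₀ ℕ) :
    powerProduct word e =
      ((e.support.sort (· ≥ ·)).flatMap fun s => List.replicate (e s) (word s)).flatten := by
  simp [powerProduct, sort_toMultiset, List.map_flatMap]

end PowerProduct

section LyndonClosed

variable {α : Type*} [LinearOrder α] {W : Set (List α)} {l w : List α}

/-- A set of words that is closed under infixes and under those products `a ++ b` for which `b`
precedes the suffixes of `a`. Such a set is determined by the powers of Lyndon words in it. -/
structure LyndonClosed (W : Set (List α)) : Prop where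
  nil_mem : [] ∈ W
  mem_of_infix {v w : List α} : v <:+: w → w ∈ W → v ∈ W
  append_mem {a b : List α} : a ∈ W → b ∈ W → PrecedesSuffixes b a → a ++ b ∈ W

/-- The least `n` for which the `n`-th power of `l` is not in `W`, or `∞`. -/
def height (W : Set (List α)) (l : List α) : ℕ∞ :=
  ⨅ n ∈ {n : ℕ | (List.replicate n l).flatten ∉ W}, (n : ℕ∞)

theorem LyndonClosed.lt_height_iff (hW : LyndonClosed W) {n : ℕ} :
    (n : ℕ∞) < height W l ↔ (List.replicate n l).flatten ∈ W := by
  constructor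
  · exact fun h => of_not_not fun hn => (h.trans_le (iInf₂_le n hn)).false
  · intro h
    have hle : ((n + 1 : ℕ) : ℕ∞) ≤ height W l := by
      refine le_iInf₂ fun m hm => Nat.cast_le.2 (Nat.succ_le_of_lt (not_le.1 fun hmn => hm ?_))
      obtain ⟨d, rfl⟩ := Nat.exists_eq_add_of_le hmn
      rw [List.replicate_add, List.flatten_append] at h
      exact hW.mem_of_infix (List.prefix_append _ _).isInfix h
    exact (Nat.cast_lt.2 n.lt_succ_self).trans_le hle

theorem LyndonClosed.mem_of_mem_of_flatten_mem (hW : LyndonClosed W) {L : List (List α)}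
    (hl : l ∈ L) (hL : L.flatten ∈ W) : l ∈ W := by
  obtain ⟨p, q, rfl⟩ := List.append_of_mem hl
  rw [List.flatten_append, List.flatten_cons, ← List.append_assoc] at hL
  exact hW.mem_of_infix (List.infix_append _ _ _) hL

/-- The list is processed from the left, where its largest elements are: all that follows a power
of a Lyndon word `word s` is then a product of words smaller than `word s`. -/
theorem LyndonClosed.flatten_flatMap_replicate_mem (hW : LyndonClosed W) {σ : Type*}
    {word : σ → List α} {T : List σ} {e : σ → ℕ} (hT : T.Pairwise fun s t => word t < word s)
    (hlyn : ∀ s ∈ T, IsLyndon (word s)) (he : ∀ s ∈ T, (e s : ℕ∞) < height W (word s)) :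
    (T.flatMap fun s => List.replicate (e s) (word s)).flatten ∈ W := by
  induction T with
  | nil => exact hW.nil_mem
  | cons s T ih =>
    rw [List.pairwise_cons] at hT
    rw [List.flatMap_cons, List.flatten_append]
    refine hW.append_mem (hW.lt_height_iff.1 (he s (by simp)))
      (ih hT.2 (fun t ht => hlyn t (by simp [ht])) fun t ht => he t (by simp [ht])) ?_
    refine (hlyn s (by simp)).flatten_precedesSuffixes_pow (e s) fun m hm => ?_
    obtain ⟨t, ht, hm⟩ := List.mem_flatMap.1 hm
    exact List.eq_of_mem_replicate hm ▸ hT.1 t ht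

variable {σ : Type*} [LinearOrder σ] {word : σ → List α}

theorem isLyndonSequence_map_sort (hword : StrictMono word) (hlyn : ∀ s, IsLyndon (word s))
    (m : Multiset σ) : IsLyndonSequence ((m.sort (· ≥ ·)).map word) where
  isLyndon := by simpa using fun s _ => hlyn s
  pairwise_ge := List.pairwise_map.2 ((m.pairwise_sort _).imp fun h => hword.monotone h)

theorem powerProduct_injective (hword : StrictMono word) (hlyn : ∀ s, IsLyndon (word s)) :
    Function.Injective (powerProduct word) := by
  intro e f h
  have hmap := IsLyndonSequence.flatten_injOn (isLyndonSequence_map_sort hword hlyn _)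
    (isLyndonSequence_map_sort hword hlyn _) h
  have hsort := congrArg ((↑) : List σ → Multiset σ) (hword.injective.list_map hmap)
  rw [Multiset.sort_eq, Multiset.sort_eq] at hsort
  exact Multiset.toFinsupp.symm.injective hsort

theorem exists_powerProduct_eq (hword : StrictMono word) {L : List (List α)}
    (hL : IsLyndonSequence L) (hrange : ∀ l ∈ L, l ∈ Set.range word) :
    ∃ e, powerProduct word e = L.flatten := by
  obtain ⟨M, rfl⟩ : L ∈ Set.range (List.map word) := Set.range_list_map word ▸ hrange
  refine ⟨Multiset.toFinsupp M, ?_⟩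
  have hM : M.Pairwise (· ≥ ·) :=
    (List.pairwise_map.1 hL.2).imp fun h => hword.le_iff_le.1 h
  rw [powerProduct, Multiset.toFinsupp_toMultiset, Multiset.coe_sort,
    List.mergeSort_eq_self _ (by simpa using hM)]

theorem LyndonClosed.bijOn_powerProduct (hW : LyndonClosed W) (hword : StrictMono word)
    (hrange : Set.range word = {l ∈ W | IsLyndon l}) :
    Set.BijOn (powerProduct word)
      {e | ∀ s ∈ e.support, (e s : ℕ∞) < height W (word s)} W := by
  have hlyn (s : σ) : IsLyndon (word s) := (hrange ▸ Set.mem_range_self s :).2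
  refine ⟨fun e he => ?_, (powerProduct_injective hword hlyn).injOn, fun w hw => ?_⟩
  · rw [powerProduct_eq_flatten_flatMap]
    refine hW.flatten_flatMap_replicate_mem ?_ (fun s _ => hlyn s)
      fun s hs => he s (by simpa using hs)
    exact (Finset.sortedGT_sort e.support).pairwise.imp fun h => hword h
  · obtain ⟨L, hL, rfl⟩ := exists_isLyndonSequence_flatten_eq w
    obtain ⟨e, he⟩ := exists_powerProduct_eq hword hL fun l hl =>
      hrange ▸ ⟨hW.mem_of_mem_of_flatten_mem hl hw, hL.1 l hl⟩
    refine ⟨e, fun s hs => hW.lt_height_iff.2 ?_, he⟩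
    rw [← he, powerProduct_eq_flatten_flatMap, List.flatMap_def, List.flatten_flatten] at hw
    refine hW.mem_of_mem_of_flatten_mem (List.mem_map.2 ⟨_, List.mem_map.2 ⟨s, ?_, rfl⟩, rfl⟩) hw
    simpa using hs

end LyndonClosed

/-! ### Spans of words over a monoid of coefficients -/

section WordProd

variable {M I : Type*} [Monoid M] (x : I → M)

/-- The product of the letters of a word. -/
def wordProd (w : List I) : M :=
  (w.map x).prod

@[simp]
theorem wordProd_nil : wordProd x [] = 1 := rfl

theorem wordProd_cons (i : I) (w : List I) : wordProd x (i :: w) = x i * wordProd x w :=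
  List.prod_cons

theorem wordProd_append (v w : List I) : wordProd x (v ++ w) = wordProd x v * wordProd x w := by
  rw [wordProd, List.map_append, List.prod_append]
  rfl

theorem wordProd_flatten (L : List (List I)) :
    wordProd x L.flatten = (L.map (wordProd x)).prod := by
  induction L with
  | nil => rfl
  | cons w L ih => rw [List.flatten_cons, wordProd_append, ih, List.map_cons, List.prod_cons]

end WordProd

section WordSpan

variable (R : Type*) {A I : Type*} [CommSemiring R] [Semiring A] [Algebra R A]
  (G : Submonoid A) (x : I → A)

/-- The span of the elements `w * g`, for words `w` in a given set and `g ∈ G`. -/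
def wordSpan (P : Set (List I)) : Submodule R A :=
  Submodule.span R (Set.image2 (fun w g => wordProd x w * g) P G)

variable {R G x} {P Q : Set (List I)} {v w : List I} {g z : A}

theorem wordProd_mul_mem (hw : w ∈ P) (hg : g ∈ G) : wordProd x w * g ∈ wordSpan R G x P :=
  Submodule.subset_span (Set.mem_image2_of_mem hw hg)

theorem wordProd_mem (hw : w ∈ P) : wordProd x w ∈ wordSpan R G x P := by
  simpa using wordProd_mul_mem (x := x) hw G.one_mem

theorem wordSpan_le {N : Submodule R A} (h : ∀ w ∈ P, ∀ g ∈ G, wordProd x w * g ∈ N) :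
    wordSpan R G x P ≤ N :=
  Submodule.span_le.2 (Set.image2_subset_iff.2 h)

theorem wordSpan_mono (h : P ⊆ Q) : wordSpan R G x P ≤ wordSpan R G x Q :=
  wordSpan_le fun _ hw _ hg => wordProd_mul_mem (h hw) hg

theorem mul_mem_wordSpan (hz : z ∈ wordSpan R G x P) (hg : g ∈ G) :
    z * g ∈ wordSpan R G x P := by
  have hle : wordSpan R G x P ≤ (wordSpan R G x P).comap (LinearMap.mulRight R g) :=
    wordSpan_le fun w hw g' hg' => by
      simpa [mul_assoc] using wordProd_mul_mem (x := x) hw (G.mul_mem hg' hg)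
  exact hle hz

theorem mem_wordSpan_of_mul_mem {g' : A} (hg' : g' ∈ G) (hgg' : g * g' = 1)
    (h : z * g ∈ wordSpan R G x P) : z ∈ wordSpan R G x P := by
  simpa [mul_assoc, hgg'] using mul_mem_wordSpan h hg'

theorem wordProd_mul_mem_wordSpan (hz : z ∈ wordSpan R G x P) (p : List I)
    (h : ∀ w ∈ P, p ++ w ∈ Q) : wordProd x p * z ∈ wordSpan R G x Q := by
  have hle : wordSpan R G x P ≤ (wordSpan R G x Q).comap (LinearMap.mulLeft R (wordProd x p)) :=
    wordSpan_le fun w hw g hg => by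
      simpa [mul_assoc, wordProd_append] using wordProd_mul_mem (x := x) (h w hw) hg
  exact hle hz

theorem letter_mul_mem_wordSpan (hz : z ∈ wordSpan R G x P) (i : I) (h : ∀ w ∈ P, i :: w ∈ Q) :
    x i * z ∈ wordSpan R G x Q := by
  simpa [wordProd] using wordProd_mul_mem_wordSpan hz [i] h

variable [LinearOrder I]

/-- `G` acts triangularly on the letters `x i`: left multiplication by `g ∈ G` turns `x i` into a
linear combination of the elements `x j * g` with `i ≤ j`. -/
def TriangularOn (R : Type*) {A I : Type*} [CommSemiring R] [Semiring A] [Algebra R A]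
    [Preorder I] (G : Submonoid A) (x : I → A) : Prop :=
  ∀ g ∈ G, ∀ i, g * x i ∈ Submodule.span R ((fun j => x j * g) '' Set.Ici i)

theorem TriangularOn.mul_wordProd_mem (hx : TriangularOn R G x) (hg : g ∈ G) (w : List I) :
    g * wordProd x w ∈ wordSpan R G x (upper w) := by
  induction w with
  | nil => simpa using wordProd_mul_mem (x := x) (mem_upper_self ([] : List I)) hg
  | cons i w ih =>
    rw [wordProd_cons, ← mul_assoc]
    have hle : Submodule.span R ((fun j => x j * g) '' Set.Ici i) ≤
        (wordSpan R G x (upper (i :: w))).comap (LinearMap.mulRight R (wordProd x w)) := by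
      refine Submodule.span_le.2 (Set.image_subset_iff.2 fun j hij => ?_)
      simpa [mul_assoc] using letter_mul_mem_wordSpan ih j fun v hv => cons_mem_upper_cons hij hv
    exact hle (hx g hg i)

theorem TriangularOn.mul_mem_wordSpan (hx : TriangularOn R G x) (hz : z ∈ wordSpan R G x P)
    (hg : g ∈ G) (h : ∀ w ∈ P, upper w ⊆ Q) : g * z ∈ wordSpan R G x Q := by
  have hle : wordSpan R G x P ≤ (wordSpan R G x Q).comap (LinearMap.mulLeft R g) :=
    wordSpan_le fun w hw g' hg' => by
      simpa [mul_assoc] using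
        PBW.mul_mem_wordSpan (wordSpan_mono (h w hw) (hx.mul_wordProd_mem hg w)) hg'
  exact hle hz

theorem TriangularOn.wordSpan_univ (hx : TriangularOn R G x)
    (hgen : Algebra.adjoin R ((G : Set A) ∪ Set.range x) = ⊤) : wordSpan R G x Set.univ = ⊤ := by
  have hmul (y : A) (hy : y ∈ Algebra.adjoin R ((G : Set A) ∪ Set.range x)) :
      ∀ z ∈ wordSpan R G x Set.univ, y * z ∈ wordSpan R G x Set.univ := by
    induction hy using Algebra.adjoin_induction with
    | mem y hy =>
      intro z hz
      rcases hy with hg | ⟨i, rfl⟩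
      · exact hx.mul_mem_wordSpan hz hg fun _ _ => Set.subset_univ _
      · exact letter_mul_mem_wordSpan hz i fun _ _ => Set.mem_univ _
    | algebraMap r => exact fun z hz => Algebra.smul_def r z ▸ Submodule.smul_mem _ r hz
    | add y y' _ _ h h' => exact fun z hz => add_mul y y' z ▸ add_mem (h z hz) (h' z hz)
    | mul y y' _ _ h h' => exact fun z hz => (mul_assoc y y' z).symm ▸ h _ (h' z hz)
  refine Submodule.eq_top_iff'.2 fun y => ?_
  simpa using hmul y (hgen ▸ Algebra.mem_top) 1 (wordProd_mem (Set.mem_univ []))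

/-! ### Irreducible words -/

variable (R G x) in
/-- The words whose product is not a linear combination of smaller words, in the shortlex order in
which lexicographically larger words come first, with coefficients from `G`. -/
def irreducibleWords : Set (List I) :=
  {w | wordProd x w ∉ wordSpan R G x (below w)}

theorem wordSpan_irreducibleWords [WellFoundedGT I] :
    wordSpan R G x (irreducibleWords R G x) = wordSpan R G x Set.univ := by
  refine (wordSpan_mono (Set.subset_univ _)).antisymm (wordSpan_le fun w _ => ?_)
  induction w using (List.Shortlex.wf (r := (· > · : I → I → Prop)) wellFounded_gt).induction with
  | _ w ih =>
    intro g hg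
    by_cases hw : wordProd x w ∈ wordSpan R G x (below w)
    · exact wordSpan_le (fun v hv => ih v hv trivial) (mul_mem_wordSpan hw hg)
    · exact wordProd_mul_mem hw hg

theorem TriangularOn.mem_irreducibleWords_of_infix (hx : TriangularOn R G x) (h : v <:+: w)
    (hw : w ∈ irreducibleWords R G x) : v ∈ irreducibleWords R G x := by
  obtain ⟨p, q, rfl⟩ := h
  refine fun hv => hw ?_
  have hle : wordSpan R G x (below v) ≤ (wordSpan R G x (below (p ++ v ++ q))).comap
      (LinearMap.mulLeft R (wordProd x p) ∘ₗ LinearMap.mulRight R (wordProd x q)) :=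
    wordSpan_le fun u hu g hg => by
      have := wordProd_mul_mem_wordSpan (Q := below (p ++ v ++ q)) (hx.mul_wordProd_mem hg q)
        (p ++ u) fun q' hq' => append_append_mem_below p hu hq'.1
      simpa [wordProd_append, mul_assoc] using this
  simpa [wordProd_append, mul_assoc] using hle hv

end WordSpan

/-! ### PBW bases from Lyndon words -/

section IsPBWBasis

variable {A I : Type*} [Ring A] {x : I → A}

theorem wordProd_powerProduct {S : Set A} [LinearOrder S] {word : S → List I}
    (hword : ∀ s, wordProd x (word s) = s) (e : S →₀ ℕ) :
    wordProd x (powerProduct word e) = monomial S e := by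
  rw [powerProduct_eq_flatten_flatMap, monomial]
  induction e.support.sort (· ≥ ·) with
  | nil => rfl
  | cons s T ih =>
    rw [List.flatMap_cons, List.flatten_append, wordProd_append, ih, List.map_cons,
      List.prod_cons, wordProd_flatten, List.map_replicate, List.prod_replicate, hword]

variable {k : Type*} [Field k] [Algebra k A] [LinearOrder I] {W : Set (List I)} {P : Set A}

theorem LyndonClosed.isPBWBasis {S : Set A} [LinearOrder S] {word : S → List I}
    (hW : LyndonClosed W) (hmono : StrictMono word)
    (hrange : Set.range word = {l ∈ W | IsLyndon l}) (hword : ∀ s, wordProd x (word s) = s)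
    (hind : LinearIndependent k fun p : W × P => wordProd x p.1.1 * p.2.1)
    (hspan : Submodule.span k (Set.image2 (fun w g => wordProd x w * g) W P) = ⊤) :
    IsPBWBasis S k P fun s => height W (word s) := by
  have hbij := hW.bijOn_powerProduct hmono hrange
  let toWord (b : Exponents S (fun s => height W (word s)) × P) : W × P :=
    (⟨powerProduct word b.1.1, hbij.mapsTo b.1.2⟩, b.2)
  have htoWord : Function.Injective toWord := fun b c h => by
    rw [Prod.mk.injEq, Subtype.mk.injEq] at h
    exact Prod.ext (Subtype.ext (hbij.injOn b.1.2 c.1.2 h.1)) h.2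
  have hprod : product S P (fun s => height W (word s)) =
      (fun p : W × P => wordProd x p.1.1 * p.2.1) ∘ toWord :=
    funext fun b => congrArg (· * (b.2 : A)) (wordProd_powerProduct hword b.1.1).symm
  have hindS : LinearIndependent k (product S P fun s => height W (word s)) :=
    hprod ▸ hind.comp toWord htoWord
  refine ⟨fun s => ?_, hindS.injective, hindS.linearIndepOn_id, ?_⟩
  · exact hW.lt_height_iff.2 (show (List.replicate 0 _).flatten ∈ W from hW.nil_mem)
  · refine top_le_iff.1 (hspan ▸ Submodule.span_mono (Set.image2_subset_iff.2 fun w hw g hg => ?_))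
    obtain ⟨e, he, rfl⟩ := hbij.surjOn hw
    exact ⟨(⟨e, he⟩, ⟨g, hg⟩), congrArg (· * g) (wordProd_powerProduct hword e).symm⟩

theorem LyndonClosed.exists_isPBWBasis (hW : LyndonClosed W) (hP : P.Nonempty)
    (hind : LinearIndependent k fun p : W × P => wordProd x p.1.1 * p.2.1)
    (hspan : Submodule.span k (Set.image2 (fun w g => wordProd x w * g) W P) = ⊤) :
    ∃ (S : Set A) (_ : LinearOrder S) (h : S → ℕ∞), IsPBWBasis S k P h := by
  obtain ⟨p, hp⟩ := hP
  have hinj : Set.InjOn (wordProd x) {l ∈ W | IsLyndon l} := fun v hv w hw h => by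
    have := hind.injective (a₁ := (⟨v, hv.1⟩, ⟨p, hp⟩)) (a₂ := (⟨w, hw.1⟩, ⟨p, hp⟩))
      (congrArg (· * p) h)
    exact congrArg (fun q : W × P => q.1.1) this
  let e := Equiv.Set.imageOfInjOn _ _ hinj
  let word (s : wordProd x '' {l ∈ W | IsLyndon l}) : List I := e.symm s
  have hword_inj : Function.Injective word := Subtype.val_injective.comp e.symm.injective
  let order : LinearOrder (wordProd x '' {l ∈ W | IsLyndon l}) := .lift' word hword_inj
  refine ⟨_, order, _, hW.isPBWBasis (word := word) (fun _ _ h => h) ?_ (fun s => ?_) hind hspan⟩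
  · rw [show word = Subtype.val ∘ e.symm from rfl, Set.range_comp, e.symm.surjective.range_eq,
      Set.image_univ, Subtype.range_coe]
  · exact congrArg Subtype.val (e.apply_symm_apply s)

end IsPBWBasis

section LinearIndependence

theorem linearIndependent_of_forall_exists_dual {R M ι κ : Type*} [CommRing R] [IsDomain R]
    [AddCommGroup M] [Module R M] (r : ι → ι → Prop) [Std.Trichotomous r] [IsTrans ι r]
    [Std.Irrefl r] (rank : κ → ι) {v : κ → M}
    (h : ∀ p, ∃ f : Module.Dual R M, f (v p) ≠ 0 ∧
      ∀ q, q ≠ p → (rank q = rank p ∨ r (rank q) (rank p)) → f (v q) = 0) :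
    LinearIndependent R v := by
  classical
  have : IsStrictTotalOrder ι r := {}
  let := linearOrderOfSTO r
  rw [linearIndependent_iff]
  intro l hl
  by_contra hne
  obtain ⟨p, hp, hmax⟩ := l.support.exists_max_image rank (Finsupp.support_nonempty_iff.2 hne)
  obtain ⟨f, hfp, hf⟩ := h p
  have hsum := congrArg f hl
  rw [Finsupp.linearCombination_apply, Finsupp.sum, map_sum, map_zero, Finset.sum_eq_single p,
    map_smul, smul_eq_mul] at hsum
  · exact mul_ne_zero (Finsupp.mem_support_iff.1 hp) hfp hsum
  · intro q hq hqp
    rw [map_smul, hf q hqp (hmax q hq).eq_or_lt, smul_zero]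
  · exact fun hp' => absurd hp hp'

end LinearIndependence

/-! ### The coproduct of a word -/

section OffCut

variable {I : Type*} {n : ℕ} {u v w : List I}

theorem Crossing.cons_right (y : I) (h : Crossing u v w) : Crossing u (y :: v) (y :: w) := by
  obtain ⟨x, u, rfl⟩ := List.exists_cons_of_ne_nil h.ne_nil.1
  exact .right x y h.shuffle

/-- `OffCut n u v w`: the word `w` is a shuffle of `u` and `v`, but not the one that cuts `w` after
`n` letters. -/
def OffCut (n : ℕ) (u v w : List I) : Prop :=
  Shuffle u v w ∧ (u.length = n → Crossing u v w)

theorem Shuffle.offCut_zero_left (h : Shuffle u v w) (x : I) :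
    OffCut 0 (x :: u) v (x :: w) :=
  ⟨h.left x, fun hu => absurd hu (Nat.succ_ne_zero _)⟩

theorem Shuffle.offCut_succ_right (h : Shuffle u v w) (y : I) :
    OffCut (n + 1) u (y :: v) (y :: w) := by
  refine ⟨h.right y, fun hu => ?_⟩
  obtain ⟨x, u, rfl⟩ := List.exists_cons_of_length_eq_add_one hu
  exact .right x y h

theorem OffCut.left (h : OffCut n u v w) (x : I) : OffCut (n + 1) (x :: u) v (x :: w) :=
  ⟨h.1.left x, fun hu => (h.2 (by simpa using hu)).left x⟩

theorem OffCut.right (h : OffCut n u v w) (y : I) : OffCut n u (y :: v) (y :: w) :=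
  ⟨h.1.right y, fun hu => (h.2 hu).cons_right y⟩

theorem OffCut.length_lt (h : OffCut w.length u v w) : u.length < w.length := by
  have hlen := h.1.length_eq
  refine lt_of_le_of_ne (by omega) fun hu => (h.2 hu).ne_nil.2 ?_
  exact List.eq_nil_of_length_eq_zero (by omega)

theorem OffCut.mem_below_or_mem_below [LinearOrder I] {a b : List I}
    (h : OffCut a.length u v (a ++ b)) (hab : PrecedesSuffixes b a) :
    u ∈ below a ∨ v ∈ below b := by
  by_cases hu : u.length = a.length
  · exact mem_below_or_mem_below_of_crossing (h.2 hu) hab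
  · have hlen := h.1.length_eq
    rw [List.length_append] at hlen
    rcases lt_or_gt_of_ne hu with hu | hu
    · exact .inl (mem_below_iff.2 (.inl hu))
    · exact .inr (mem_below_iff.2 (.inl (by omega)))

end OffCut

section TensorSpan

variable (R : Type*) {A I : Type*} [CommSemiring R] [Semiring A] [Algebra R A] [LinearOrder I]
  (G : Submonoid A) (x : I → A)

/-- The span of the tensors that come from the shuffles of `w`, of a kind given by `Q`, up to
replacing the two constituents by words that are not smaller. -/
def tensorSpan (Q : List I → List I → List I → Prop) (w : List I) : Submodule R (A ⊗[R] A) :=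
  Submodule.span R {t | ∃ u v, Q u v w ∧
    ∃ y ∈ wordSpan R G x (upper u), ∃ z ∈ wordSpan R G x (upper v), y ⊗ₜ[R] z = t}

variable {R G x} {Q Q' : List I → List I → List I → Prop} {u v w w' : List I} {g y z : A}
  {t : A ⊗[R] A}

theorem tmul_mem_tensorSpan (h : Q u v w) (hy : y ∈ wordSpan R G x (upper u))
    (hz : z ∈ wordSpan R G x (upper v)) : y ⊗ₜ[R] z ∈ tensorSpan R G x Q w :=
  Submodule.subset_span ⟨u, v, h, y, hy, z, hz, rfl⟩

theorem tensorSpan_le {N : Submodule R (A ⊗[R] A)}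
    (h : ∀ u v, Q u v w → ∀ y ∈ wordSpan R G x (upper u), ∀ z ∈ wordSpan R G x (upper v),
      y ⊗ₜ[R] z ∈ N) : tensorSpan R G x Q w ≤ N := by
  refine Submodule.span_le.2 ?_
  rintro _ ⟨u, v, hQ, y, hy, z, hz, rfl⟩
  exact h u v hQ y hy z hz

theorem mul_tmul_mem_tensorSpan (ht : t ∈ tensorSpan R G x Q w) (hg : g ∈ G) :
    t * g ⊗ₜ[R] g ∈ tensorSpan R G x Q w := by
  have hle : tensorSpan R G x Q w ≤
      (tensorSpan R G x Q w).comap (LinearMap.mulRight R (g ⊗ₜ[R] g)) :=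
    tensorSpan_le fun u v h y hy z hz => by
      simpa using tmul_mem_tensorSpan h (mul_mem_wordSpan hy hg) (mul_mem_wordSpan hz hg)
  exact hle ht

theorem letter_tmul_one_mul_mem_tensorSpan (ht : t ∈ tensorSpan R G x Q w) (i : I)
    (h : ∀ u v, Q u v w → Q' (i :: u) v (i :: w)) :
    x i ⊗ₜ[R] 1 * t ∈ tensorSpan R G x Q' (i :: w) := by
  have hle : tensorSpan R G x Q w ≤
      (tensorSpan R G x Q' (i :: w)).comap (LinearMap.mulLeft R (x i ⊗ₜ[R] 1)) :=
    tensorSpan_le fun u v huv y hy z hz => by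
      simpa using tmul_mem_tensorSpan (h u v huv)
        (letter_mul_mem_wordSpan hy i fun _ => cons_mem_upper_cons le_rfl) hz
  exact hle ht

theorem TriangularOn.tmul_letter_mul_mem_tensorSpan (hx : TriangularOn R G x)
    (ht : t ∈ tensorSpan R G x Q w) (hg : g ∈ G) (i : I)
    (h : ∀ u v, Q u v w → Q' u (i :: v) (i :: w)) :
    g ⊗ₜ[R] x i * t ∈ tensorSpan R G x Q' (i :: w) := by
  have hle : tensorSpan R G x Q w ≤
      (tensorSpan R G x Q' (i :: w)).comap (LinearMap.mulLeft R (g ⊗ₜ[R] x i)) :=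
    tensorSpan_le fun u v huv y hy z hz => by
      simpa using tmul_mem_tensorSpan (h u v huv)
        (hx.mul_mem_wordSpan hy hg fun _ => upper_subset_upper)
        (letter_mul_mem_wordSpan hz i fun _ => cons_mem_upper_cons le_rfl)
  exact hle ht

end TensorSpan

theorem tensorSpan_le_ker_dualDistrib {k A I : Type*} [CommSemiring k] [Semiring A] [Algebra k A]
    [LinearOrder I] {G : Submonoid A} {x : I → A} {Q : List I → List I → List I → Prop}
    {φ ψ : Module.Dual k A} {U V : Set (List I)} {w : List I} (hφ : wordSpan k G x U ≤ φ.ker)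
    (hψ : wordSpan k G x V ≤ ψ.ker) (hQ : ∀ u v, Q u v w → upper u ⊆ U ∨ upper v ⊆ V) :
    tensorSpan k G x Q w ≤ (TensorProduct.dualDistrib k A A (φ ⊗ₜ ψ)).ker := by
  refine tensorSpan_le fun u v huv y hy z hz => ?_
  rw [LinearMap.mem_ker, TensorProduct.dualDistrib_apply]
  rcases hQ u v huv with hU | hV
  · rw [LinearMap.mem_ker.1 (hφ (wordSpan_mono hU hy)), zero_mul]
  · rw [LinearMap.mem_ker.1 (hψ (wordSpan_mono hV hz)), mul_zero]

/-- Letters `x i` of a bialgebra with `Δ (x i) = x i ⊗ 1 + γ i ⊗ x i`, on which a group `G` of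
group-like elements that contains the `γ i` acts triangularly. -/
structure SkewPrimitiveAlphabet (k : Type*) {H I : Type*} [CommSemiring k] [Semiring H]
    [Bialgebra k H] [LinearOrder I] (G : Submonoid H) (x γ : I → H) : Prop where
  isGroupLikeElem : ∀ g ∈ G, IsGroupLikeElem k g
  exists_right_inv : ∀ g ∈ G, ∃ g' ∈ G, g * g' = 1
  gamma_mem : ∀ i, γ i ∈ G
  comul_letter : ∀ i, Coalgebra.comul (R := k) (x i) = x i ⊗ₜ[k] 1 + γ i ⊗ₜ[k] x i
  triangularOn : TriangularOn k G x

namespace SkewPrimitiveAlphabet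

section Ring

variable {k H I : Type*} [CommRing k] [Ring H] [Bialgebra k H] [LinearOrder I] {G : Submonoid H}
  {x γ : I → H} {g : H} (hx : SkewPrimitiveAlphabet k G x γ)

include hx

theorem wordProd_gamma_mem (w : List I) : wordProd γ w ∈ G :=
  G.list_prod_mem fun g hg => by
    obtain ⟨i, -, rfl⟩ := List.mem_map.1 hg
    exact hx.gamma_mem i

theorem comul_wordProd_mem (w : List I) :
    Coalgebra.comul (R := k) (wordProd x w) ∈ tensorSpan k G x Shuffle w := by
  induction w with
  | nil =>
    rw [wordProd_nil, Bialgebra.comul_one, Algebra.TensorProduct.one_def]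
    exact tmul_mem_tensorSpan .nil (wordProd_mem (mem_upper_self []))
      (wordProd_mem (mem_upper_self []))
  | cons i w ih =>
    rw [wordProd_cons, Bialgebra.comul_mul, hx.comul_letter, add_mul]
    exact add_mem (letter_tmul_one_mul_mem_tensorSpan ih i fun _ _ h => h.left i)
      (hx.triangularOn.tmul_letter_mul_mem_tensorSpan ih (hx.gamma_mem i) i fun _ _ h => h.right i)

theorem comul_wordProd_sub_mem (b : List I) :
    Coalgebra.comul (R := k) (wordProd x b) - wordProd γ b ⊗ₜ[k] wordProd x b ∈
      tensorSpan k G x (OffCut 0) b := by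
  induction b with
  | nil => simp [Algebra.TensorProduct.one_def]
  | cons i b ih =>
    have hsplit : Coalgebra.comul (R := k) (wordProd x (i :: b)) -
        wordProd γ (i :: b) ⊗ₜ[k] wordProd x (i :: b) =
        x i ⊗ₜ[k] 1 * Coalgebra.comul (R := k) (wordProd x b) +
          γ i ⊗ₜ[k] x i *
            (Coalgebra.comul (R := k) (wordProd x b) - wordProd γ b ⊗ₜ[k] wordProd x b) := by
      rw [wordProd_cons, wordProd_cons, Bialgebra.comul_mul, hx.comul_letter, add_mul, mul_sub,
        Algebra.TensorProduct.tmul_mul_tmul, add_sub_assoc]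
    rw [hsplit]
    exact add_mem
      (letter_tmul_one_mul_mem_tensorSpan (hx.comul_wordProd_mem b) i
        fun _ _ h => h.offCut_zero_left i)
      (hx.triangularOn.tmul_letter_mul_mem_tensorSpan ih (hx.gamma_mem i) i fun _ _ h => h.right i)

theorem comul_wordProd_append_sub_mem (a b : List I) :
    Coalgebra.comul (R := k) (wordProd x (a ++ b)) -
        (wordProd x a * wordProd γ b) ⊗ₜ[k] wordProd x b ∈
      tensorSpan k G x (OffCut a.length) (a ++ b) := by
  induction a with
  | nil => simpa using hx.comul_wordProd_sub_mem b
  | cons i a ih =>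
    have hsplit : Coalgebra.comul (R := k) (wordProd x (i :: a ++ b)) -
        (wordProd x (i :: a) * wordProd γ b) ⊗ₜ[k] wordProd x b =
        x i ⊗ₜ[k] 1 * (Coalgebra.comul (R := k) (wordProd x (a ++ b)) -
            (wordProd x a * wordProd γ b) ⊗ₜ[k] wordProd x b) +
          γ i ⊗ₜ[k] x i * Coalgebra.comul (R := k) (wordProd x (a ++ b)) := by
      rw [List.cons_append, wordProd_cons, wordProd_cons, Bialgebra.comul_mul, hx.comul_letter,
        add_mul, mul_sub, Algebra.TensorProduct.tmul_mul_tmul, one_mul, mul_assoc,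
        sub_add_eq_add_sub]
    rw [hsplit]
    exact add_mem (letter_tmul_one_mul_mem_tensorSpan ih i fun _ _ h => h.left i)
      (hx.triangularOn.tmul_letter_mul_mem_tensorSpan (hx.comul_wordProd_mem _) (hx.gamma_mem i) i
        fun _ _ h => h.offCut_succ_right i)

theorem comul_wordProd_mul_mem (w : List I) (hg : g ∈ G) :
    Coalgebra.comul (R := k) (wordProd x w * g) ∈ tensorSpan k G x Shuffle w := by
  rw [Bialgebra.comul_mul, (hx.isGroupLikeElem g hg).comul_eq_tmul_self]
  exact mul_tmul_mem_tensorSpan (hx.comul_wordProd_mem w) hg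

theorem comul_wordProd_mul_sub_mem (w : List I) (hg : g ∈ G) :
    Coalgebra.comul (R := k) (wordProd x w * g) - (wordProd x w * g) ⊗ₜ[k] g ∈
      tensorSpan k G x (OffCut w.length) w := by
  rw [Bialgebra.comul_mul, (hx.isGroupLikeElem g hg).comul_eq_tmul_self]
  simpa [sub_mul] using mul_tmul_mem_tensorSpan (hx.comul_wordProd_append_sub_mem w []) hg

end Ring

/-! ### The irreducible words of a skew-primitive alphabet -/

variable {k H I : Type*} [Field k] [Ring H] [Bialgebra k H] [LinearOrder I] {G : Submonoid H}
  {x γ : I → H} (hx : SkewPrimitiveAlphabet k G x γ)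

include hx

theorem wordProd_mul_notMem {w : List I} {g : H} (hw : w ∈ irreducibleWords k G x) (hg : g ∈ G) :
    wordProd x w * g ∉ wordSpan k G x (below w) := by
  obtain ⟨g', hg', hgg'⟩ := hx.exists_right_inv g hg
  exact fun h => hw (mem_wordSpan_of_mul_mem hg' hgg' h)

theorem append_mem_irreducibleWords {a b : List I} (ha : a ∈ irreducibleWords k G x)
    (hb : b ∈ irreducibleWords k G x) (hab : PrecedesSuffixes b a) :
    a ++ b ∈ irreducibleWords k G x := by
  intro hred
  obtain ⟨φ, hφ, hφ_below⟩ := Submodule.exists_le_ker_of_notMem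
    (hx.wordProd_mul_notMem ha (hx.wordProd_gamma_mem b))
  obtain ⟨ψ, hψ, hψ_below⟩ := Submodule.exists_le_ker_of_notMem hb
  set θ := TensorProduct.dualDistrib k H H (φ ⊗ₜ ψ)
  have hupper {u v : List I} : u ∈ below a ∨ v ∈ below b → upper u ⊆ below a ∨ upper v ⊆ below b :=
    Or.imp upper_subset_below upper_subset_below
  have hle : wordSpan k G x (below (a ++ b)) ≤ (θ.ker).comap Coalgebra.comul :=
    wordSpan_le fun w hw g hg => tensorSpan_le_ker_dualDistrib hφ_below hψ_below
      (fun _ _ h => hupper (mem_below_or_mem_below_of_shuffle h hab hw))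
      (hx.comul_wordProd_mul_mem w hg)
  have hcomul : θ (Coalgebra.comul (R := k) (wordProd x (a ++ b))) = 0 := hle hred
  have hcut := tensorSpan_le_ker_dualDistrib hφ_below hψ_below
    (fun _ _ h => hupper (h.mem_below_or_mem_below hab)) (hx.comul_wordProd_append_sub_mem a b)
  rw [LinearMap.mem_ker, map_sub, hcomul, zero_sub, neg_eq_zero,
    TensorProduct.dualDistrib_apply] at hcut
  exact mul_ne_zero hφ hψ hcut

theorem lyndonClosed_irreducibleWords : LyndonClosed (irreducibleWords k G x) where
  nil_mem h := by
    have hbot : wordSpan k G x (below []) ≤ ⊥ :=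
      wordSpan_le fun _ hv => absurd hv notMem_below_nil
    exact (hx.isGroupLikeElem 1 G.one_mem).ne_zero (hbot h)
  mem_of_infix h := hx.triangularOn.mem_irreducibleWords_of_infix h
  append_mem := hx.append_mem_irreducibleWords

theorem dualDistrib_comul_wordProd_mul {w v : List I} {g : H} {χ φ : Module.Dual k H}
    (hχ : wordSpan k G x (below w) ≤ χ.ker) (hv : v = w ∨ v ∈ below w) (hg : g ∈ G) :
    TensorProduct.dualDistrib k H H (χ ⊗ₜ φ) (Coalgebra.comul (wordProd x v * g)) =
      χ (wordProd x v * g) * φ g := by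
  have hempty : wordSpan k G x ∅ ≤ φ.ker := wordSpan_le fun _ h => absurd h (Set.notMem_empty _)
  rw [← TensorProduct.dualDistrib_apply, ← sub_eq_zero, ← map_sub, ← LinearMap.mem_ker]
  refine tensorSpan_le_ker_dualDistrib hχ hempty (fun u t h => .inl (upper_subset_below ?_))
    (hx.comul_wordProd_mul_sub_mem v hg)
  have huv : u ∈ below v := mem_below_iff.2 (.inl h.length_lt)
  rcases hv with rfl | hv
  exacts [huv, below_subset_below hv huv]

theorem linearIndependent_irreducibleWords :
    LinearIndependent k fun p : irreducibleWords k G x × G => wordProd x p.1.1 * p.2.1 := by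
  have : IsTrans (List I) (List.Shortlex (· > ·)) := ⟨fun _ _ _ h h' => below_subset_below h' h⟩
  refine linearIndependent_of_forall_exists_dual (List.Shortlex (· > ·))
    (fun p : irreducibleWords k G x × G => p.1.1) fun ⟨⟨w, hw⟩, ⟨g, hg⟩⟩ => ?_
  obtain ⟨χ, hχ, hχ_below⟩ := Submodule.exists_le_ker_of_notMem (hx.wordProd_mul_notMem hw hg)
  have hindep : LinearIndependent k (Subtype.val : G → H) :=
    (linearIndepOn_isGroupLikeElem (R := k)).mono hx.isGroupLikeElem
  obtain ⟨φ, hφ, hφ_ne⟩ := Submodule.exists_le_ker_of_notMem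
    (hindep.notMem_span_image (s := {⟨g, hg⟩}ᶜ) (x := ⟨g, hg⟩) (by simp))
  have hconv (v : List I) (g' : G) := hx.dualDistrib_comul_wordProd_mul (φ := φ) hχ_below (v := v)
    (g := g') (hg := g'.2)
  refine ⟨TensorProduct.dualDistrib k H H (χ ⊗ₜ φ) ∘ₗ Coalgebra.comul, ?_, ?_⟩
  · exact (hconv w ⟨g, hg⟩ (.inl rfl)).trans_ne (mul_ne_zero hχ hφ)
  · intro ⟨⟨v, _⟩, g'⟩ hne hv
    refine (hconv v g' hv).trans ?_
    rcases hv with rfl | hv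
    · have hg' : g' ∈ ({⟨g, hg⟩}ᶜ : Set G) := fun h => hne (by rw [Set.mem_singleton_iff.1 h])
      rw [LinearMap.mem_ker.1 (hφ_ne (Submodule.subset_span (Set.mem_image_of_mem _ hg'))),
        mul_zero]
    · rw [LinearMap.mem_ker.1 (hχ_below (wordProd_mul_mem hv g'.2)), zero_mul]

theorem exists_isPBWBasis [WellFoundedGT I]
    (hgen : Algebra.adjoin k ((G : Set H) ∪ Set.range x) = ⊤) :
    ∃ (S : Set H) (_ : LinearOrder S) (h : S → ℕ∞), IsPBWBasis S k (G : Set H) h :=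
  hx.lyndonClosed_irreducibleWords.exists_isPBWBasis ⟨1, G.one_mem⟩
    hx.linearIndependent_irreducibleWords
    (wordSpan_irreducibleWords.trans (hx.triangularOn.wordSpan_univ hgen))

end SkewPrimitiveAlphabet

/-! ### Simultaneous triangularization -/

section Triangularization

variable {k ι : Type*} [Field k] [IsAlgClosed k]

theorem exists_common_eigenvector {V : Type*} [AddCommGroup V] [Module k V] [FiniteDimensional k V]
    [Nontrivial V] (f : ι → Module.End k V) (hf : ∀ i j, Commute (f i) (f j)) :
    ∃ v ≠ 0, ∀ i, ∃ c : k, f i v = c • v := by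
  induction hn : Module.finrank k V using Nat.strong_induction_on generalizing V with
  | _ n ih =>
    by_cases hscalar : ∀ i, ∃ c : k, ∀ v, f i v = c • v
    · obtain ⟨v, hv⟩ := exists_ne (0 : V)
      exact ⟨v, hv, fun i => (hscalar i).imp fun _ hc => hc v⟩
    · push Not at hscalar
      obtain ⟨i, hi⟩ := hscalar
      obtain ⟨c, hc⟩ := Module.End.exists_eigenvalue (f i)
      set E := Module.End.eigenspace (f i) c
      have hE (j : ι) : ∀ v ∈ E, f j v ∈ E :=
        Module.End.mapsTo_genEigenspace_of_comm (hf i j) c 1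
      have hne_top : E ≠ ⊤ := fun htop => by
        obtain ⟨v, hv⟩ := hi c
        exact hv (Module.End.mem_eigenspace_iff.1 (htop ▸ Submodule.mem_top : v ∈ E))
      have : Nontrivial E := Submodule.nontrivial_iff_ne_bot.2 hc
      obtain ⟨v, hv, heigen⟩ := ih _ (hn ▸ Submodule.finrank_lt hne_top)
        (fun j => (f j).restrict (hE j))
        (fun j l => LinearMap.ext fun v => Subtype.ext (LinearMap.congr_fun (hf j l).eq v)) rfl
      exact ⟨v, fun h => hv (Subtype.ext h),
        fun j => (heigen j).imp fun _ hb => congrArg Subtype.val hb⟩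

theorem exists_triangular_basis {V : Type*} [AddCommGroup V] [Module k V] [FiniteDimensional k V]
    {n : ℕ} (hn : Module.finrank k V = n) (f : ι → Module.End k V)
    (hf : ∀ i j, Commute (f i) (f j)) :
    ∃ b : Module.Basis (Fin n) k V, ∀ i j, f i (b j) ∈ Submodule.span k (b '' Set.Ici j) := by
  induction n generalizing V with
  | zero => exact ⟨Module.finBasisOfFinrankEq k V hn, fun _ j => j.elim0⟩
  | succ n ih =>
    have : Nontrivial V := Module.nontrivial_of_finrank_eq_succ hn
    obtain ⟨φ, hφ, heigen⟩ := exists_common_eigenvector (fun i => (f i).dualMap) fun i j =>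
      LinearMap.ext fun ψ => congrArg (ψ ∘ₗ ·) (hf j i).eq
    have hker (i : ι) : ∀ v ∈ φ.ker, f i v ∈ φ.ker := fun v hv => by
      obtain ⟨c, hc⟩ := heigen i
      rw [LinearMap.mem_ker] at hv ⊢
      rw [← LinearMap.dualMap_apply, hc, LinearMap.smul_apply, hv, smul_zero]
    have hfinrank : Module.finrank k φ.ker = n := by
      have := Module.Dual.finrank_ker_add_one_of_ne_zero hφ
      omega
    obtain ⟨b, hb⟩ := ih hfinrank (fun i => (f i).restrict (hker i))
      (fun i j => LinearMap.ext fun v => Subtype.ext (LinearMap.congr_fun (hf i j).eq v))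
    obtain ⟨y, hy⟩ := DFunLike.exists_ne hφ
    rw [LinearMap.zero_apply] at hy
    set b' := Module.Basis.mkFinCons y b
      (fun c x hx hcx => by simpa [LinearMap.mem_ker.1 hx, hy] using congrArg φ hcx)
      (fun z => ⟨-(φ z / φ y), by simp [hy]⟩)
    have hb'_succ (j : Fin n) : b' j.succ = b j := by simp [b']
    refine ⟨b', fun i j => ?_⟩
    induction j using Fin.cases with
    | zero =>
      rw [← bot_eq_zero, Set.Ici_bot, Set.image_univ, b'.span_eq]
      exact Submodule.mem_top
    | succ j =>
      have hmap := Submodule.mem_map_of_mem (f := φ.ker.subtype) (hb i j)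
      rw [Submodule.map_span, Set.image_image] at hmap
      rw [hb'_succ]
      refine Submodule.span_mono ?_ hmap
      rintro _ ⟨l, hl, rfl⟩
      exact ⟨l.succ, Fin.succ_le_succ_iff.2 hl, hb'_succ l⟩

theorem exists_triangular_family {V : Type*} [AddCommGroup V] [Module k V] (W : Submodule k V)
    [FiniteDimensional k W] (f : ι → Module.End k V) (hf : ∀ i j, Commute (f i) (f j))
    (hW : ∀ i, ∀ v ∈ W, f i v ∈ W) :
    ∃ (n : ℕ) (y : Fin n → V), Submodule.span k (Set.range y) = W ∧
      ∀ i j, f i (y j) ∈ Submodule.span k (y '' Set.Ici j) := by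
  obtain ⟨b, hb⟩ := exists_triangular_basis rfl (fun i => (f i).restrict (hW i))
    fun i j => LinearMap.ext fun v => Subtype.ext (LinearMap.congr_fun (hf i j).eq v)
  refine ⟨_, W.subtype ∘ b, ?_, fun i j => ?_⟩
  · rw [Set.range_comp, ← Submodule.map_span, b.span_eq, Submodule.map_subtype_top]
  · rw [Set.image_comp, ← Submodule.map_span]
    exact Submodule.mem_map_of_mem (hb i j)

end Triangularization

/-! ### The adjoint action of group-like elements -/

section Adjoint

variable {k H : Type*} [Field k] [Ring H] [HopfAlgebra k H] {c g h : GroupLike k H} {y : H}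

/-- The adjoint action as a representation of the group of group-like elements. -/
def adjointRepresentation (k H : Type*) [Field k] [Ring H] [HopfAlgebra k H] :
    Representation k (GroupLike k H) H where
  toFun g := LinearMap.mulRight k ((g⁻¹ : GroupLike k H) : H) ∘ₗ LinearMap.mulLeft k (g : H)
  map_one' := by
    ext
    simp
  map_mul' g h := by
    ext
    simp [mul_assoc]

theorem groupLike_mul_eq (g : GroupLike k H) (y : H) :
    (g : H) * y = adjointAction g y * (g : H) := by
  rw [adjointAction, mul_assoc, ← GroupLike.val_mul, inv_mul_cancel, GroupLike.val_one, mul_one]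

theorem IsSkewPrimitive.mul_groupLike (hy : IsSkewPrimitive k g h y) (c : GroupLike k H) :
    IsSkewPrimitive k (g * c) (h * c) (y * (c : H)) := by
  rw [IsSkewPrimitive, Bialgebra.comul_mul, hy, c.isGroupLikeElem_val.comul_eq_tmul_self, add_mul,
    Algebra.TensorProduct.tmul_mul_tmul, Algebra.TensorProduct.tmul_mul_tmul, GroupLike.val_mul,
    GroupLike.val_mul]

theorem IsSkewPrimitive.groupLike_mul (hy : IsSkewPrimitive k g h y) (c : GroupLike k H) :
    IsSkewPrimitive k (c * g) (c * h) ((c : H) * y) := by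
  rw [IsSkewPrimitive, Bialgebra.comul_mul, hy, c.isGroupLikeElem_val.comul_eq_tmul_self, mul_add,
    Algebra.TensorProduct.tmul_mul_tmul, Algebra.TensorProduct.tmul_mul_tmul, GroupLike.val_mul,
    GroupLike.val_mul]

theorem IsSkewPrimitive.adjointAction (hy : IsSkewPrimitive k g h y) (hg : c * g = g * c)
    (hh : c * h = h * c) : IsSkewPrimitive k g h (adjointAction c y) := by
  have hconj := (hy.groupLike_mul c).mul_groupLike c⁻¹
  rwa [hg, hh, mul_inv_cancel_right, mul_inv_cancel_right] at hconj

theorem IsSkewPrimitive.comul_mul_inv (hy : IsSkewPrimitive k g h y) :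
    Coalgebra.comul (R := k) (y * ((h⁻¹ : GroupLike k H) : H)) =
      (y * ((h⁻¹ : GroupLike k H) : H)) ⊗ₜ[k] 1 +
        ((g * h⁻¹ : GroupLike k H) : H) ⊗ₜ[k] (y * ((h⁻¹ : GroupLike k H) : H)) := by
  have hmul := hy.mul_groupLike h⁻¹
  rwa [IsSkewPrimitive, mul_inv_cancel, GroupLike.val_one, add_comm] at hmul

/-- The space of `(g, h)`-skew-primitive elements. -/
def skewPrimitives (g h : GroupLike k H) : Submodule k H :=
  LinearMap.eqLocus (Coalgebra.comul (R := k) (A := H))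
    (TensorProduct.mk k H H (g : H) + (TensorProduct.mk k H H).flip (h : H))

theorem mem_skewPrimitives : y ∈ skewPrimitives g h ↔ IsSkewPrimitive k g h y := Iff.rfl

variable {G : Subgroup (GroupLike k H)}

theorem exists_triangular_skewPrimitives [IsAlgClosed k] (hG : ∀ x ∈ G, ∀ y ∈ G, x * y = y * x)
    (hg : g ∈ G) (hh : h ∈ G) (N : Submodule k H) [FiniteDimensional k N]
    (hN : ∀ c ∈ G, ∀ y ∈ N, adjointAction c y ∈ N) :
    ∃ (n : ℕ) (y : Fin n → H), Submodule.span k (Set.range y) = N ⊓ skewPrimitives g h ∧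
      ∀ c ∈ G, ∀ j, adjointAction c (y j) ∈ Submodule.span k (y '' Set.Ici j) := by
  obtain ⟨n, y, hspan, hy⟩ := exists_triangular_family (N ⊓ skewPrimitives g h)
    (fun c : G => adjointRepresentation k H c)
    (fun b c => (show Commute (b : GroupLike k H) c from hG b b.2 c c.2).map _)
    fun c v hv => ⟨hN c c.2 v hv.1, (mem_skewPrimitives.1 hv.2).adjointAction (hG c c.2 g hg)
      (hG c c.2 h hh)⟩
  exact ⟨n, y, hspan, fun c hc j => hy ⟨c, hc⟩ j⟩

/-- A subgroup of group-like elements as a submonoid of the Hopf algebra. -/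
def groupLikeSubmonoid (G : Subgroup (GroupLike k H)) : Submonoid H :=
  G.toSubmonoid.map (GroupLike.valMonoidHom k H)

section NormalizedLetters

variable {ι : Type*} {J : ι → Type*}

/-- The elements `y i j` turned into letters `y i j * (h i)⁻¹`, which satisfy
`Δ(x) = x ⊗ 1 + γ ⊗ x` if `y i j` is `(g i, h i)`-skew-primitive. The indices are ordered
lexicographically. -/
def normalizedLetters (y : ∀ i, J i → H) (h : ι → GroupLike k H) (p : Σₗ i, J i) : H :=
  y p.1 p.2 * (((h p.1)⁻¹ : GroupLike k H) : H)

variable {y : ∀ i, J i → H} {g h : ι → GroupLike k H}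

theorem triangularOn_normalizedLetters [Preorder ι] [∀ i, Preorder (J i)]
    (hG : ∀ x ∈ G, ∀ y ∈ G, x * y = y * x) (hh : ∀ i, h i ∈ G)
    (hyG : ∀ i, ∀ c ∈ G, ∀ j, adjointAction c (y i j) ∈ Submodule.span k (y i '' Set.Ici j)) :
    TriangularOn k (groupLikeSubmonoid G) (normalizedLetters y h) := by
  rintro _ ⟨c, hc, rfl⟩ p
  set b := (h p.1)⁻¹
  have hle : Submodule.span k (y p.1 '' Set.Ici p.2) ≤
      (Submodule.span k ((fun q => normalizedLetters y h q * (c : H)) '' Set.Ici p)).comap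
        (LinearMap.mulRight k ((b : H) * (c : H))) := by
    refine Submodule.span_le.2 ?_
    rintro _ ⟨j, hj, rfl⟩
    exact Submodule.subset_span ⟨⟨p.1, j⟩, Sigma.Lex.right _ _ hj, mul_assoc _ _ _⟩
  have hcomm : (c : H) * normalizedLetters y h p =
      adjointAction c (y p.1 p.2) * ((b : H) * (c : H)) := by
    rw [normalizedLetters, ← mul_assoc, groupLike_mul_eq, mul_assoc, ← GroupLike.val_mul,
      hG c hc _ (G.inv_mem (hh p.1)), GroupLike.val_mul]
  exact hcomm ▸ (hle (hyG p.1 c hc p.2) :)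

theorem skewPrimitiveAlphabet_normalizedLetters [LinearOrder ι] [∀ i, LinearOrder (J i)]
    (hG : ∀ x ∈ G, ∀ y ∈ G, x * y = y * x) (hg : ∀ i, g i ∈ G) (hh : ∀ i, h i ∈ G)
    (hy : ∀ i j, IsSkewPrimitive k (g i) (h i) (y i j))
    (hyG : ∀ i, ∀ c ∈ G, ∀ j, adjointAction c (y i j) ∈ Submodule.span k (y i '' Set.Ici j)) :
    SkewPrimitiveAlphabet k (groupLikeSubmonoid G) (normalizedLetters y h)
      fun p => ((g p.1 * (h p.1)⁻¹ : GroupLike k H) : H) where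
  isGroupLikeElem := by
    rintro _ ⟨c, -, rfl⟩
    exact c.isGroupLikeElem_val
  exists_right_inv := by
    rintro _ ⟨c, hc, rfl⟩
    exact ⟨_, ⟨c⁻¹, G.inv_mem hc, rfl⟩, by rw [← map_mul, mul_inv_cancel, map_one]⟩
  gamma_mem p := ⟨_, G.mul_mem (hg p.1) (G.inv_mem (hh p.1)), rfl⟩
  comul_letter p := (hy p.1 p.2).comul_mul_inv
  triangularOn := triangularOn_normalizedLetters hG hh hyG

theorem adjoin_le_adjoin_normalizedLetters {a : ι → H}
    (hh : ∀ i, h i ∈ G) (ha : ∀ i, a i ∈ Submodule.span k (Set.range (y i))) :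
    Algebra.adjoin k ((groupLikeSubmonoid G : Set H) ∪ Set.range a) ≤
      Algebra.adjoin k ((groupLikeSubmonoid G : Set H) ∪ Set.range (normalizedLetters y h)) := by
  set B := Algebra.adjoin k ((groupLikeSubmonoid G : Set H) ∪ Set.range (normalizedLetters y h))
  have hletter (i : ι) (j : J i) : y i j ∈ B := by
    have hy : normalizedLetters y h ⟨i, j⟩ * (h i : H) = y i j := by
      change y i j * (((h i)⁻¹ : GroupLike k H) : H) * (h i : H) = y i j
      rw [mul_assoc, ← GroupLike.val_mul, inv_mul_cancel, GroupLike.val_one, mul_one]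
    rw [← hy]
    exact B.mul_mem (Algebra.subset_adjoin (.inr ⟨_, rfl⟩))
      (Algebra.subset_adjoin (.inl ⟨h i, hh i, rfl⟩))
  have hspan (i : ι) : Submodule.span k (Set.range (y i)) ≤ Subalgebra.toSubmodule B :=
    Submodule.span_le.2 (Set.range_subset_iff.2 (hletter i))
  exact Algebra.adjoin_le (Set.union_subset (Set.subset_union_left.trans Algebra.subset_adjoin)
    (Set.range_subset_iff.2 fun i => hspan i (ha i)))

end NormalizedLetters

end Adjoint

end PBW

end

theorem mainTheorem5 {k : Type*} [Field k] [IsAlgClosed k] {H : Type*} [Ring H] [HopfAlgebra k H]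
    (G : Subgroup (GroupLike k H)) (hG : ∀ x ∈ G, ∀ y ∈ G, x * y = y * x)
    (t : ℕ) (a : Fin t → H)
    (ha : ∀ i, ∃ g ∈ G, ∃ h ∈ G, PBW.IsSkewPrimitive k g h (a i))
    (hstable : ∀ g ∈ G, ∀ x ∈ Submodule.span k (Set.range a),
      PBW.adjointAction g x ∈ Submodule.span k (Set.range a))
    (hgen : Algebra.adjoin k ((fun g : GroupLike k H => (g : H)) '' (G : Set (GroupLike k H)) ∪
      Set.range a) = ⊤) :
    ∃ (S : Set H) (_ : LinearOrder S) (h : S → ℕ∞),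
      PBW.IsPBWBasis S k ((fun g : GroupLike k H => (g : H)) '' (G : Set (GroupLike k H))) h := by
  choose g hg h hh ha using ha
  have : FiniteDimensional k (Submodule.span k (Set.range a)) :=
    FiniteDimensional.span_of_finite k (Set.finite_range a)
  choose d y hspan hyG using fun i =>
    PBW.exists_triangular_skewPrimitives hG (hg i) (hh i) (Submodule.span k (Set.range a)) hstable
  have hy (i : Fin t) (j : Fin (d i)) : PBW.IsSkewPrimitive k (g i) (h i) (y i j) :=
    ((hspan i).le (Submodule.subset_span ⟨j, rfl⟩)).2
  have hay (i : Fin t) : a i ∈ Submodule.span k (Set.range (y i)) :=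
    (hspan i).ge ⟨Submodule.subset_span ⟨i, rfl⟩, ha i⟩
  have : Finite (Σₗ i, Fin (d i)) := inferInstanceAs (Finite (Σ i, Fin (d i)))
  refine (PBW.skewPrimitiveAlphabet_normalizedLetters hG hg hh hy hyG).exists_isPBWBasis ?_
  exact top_le_iff.1 (hgen.ge.trans (PBW.adjoin_le_adjoin_normalizedLetters hh hay))
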